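/- **Theorem 4.2.** Let $(F,g_F)$ be a connected smooth Riemannian manifold without boundary of dimension $s\ge 2$, let $f:F\to(0,\infty)$ be smooth, let $I=(t_1,t_2)$ with $-\infty\le t_1<t_2\le\infty$, and let $M=I\times F$ carry the Lorentzian metric $g=-f^2\,\mathrm dt^2\oplus g_F$ (a standard static space-time). Let $\mathrm{Ric}_F$ be the Ricci tensor of $g_F$, $H_F^f$ the Hessian of $f$, i.e. $H_F^f(X,Y)=g_F(\nabla^F_X\,\mathrm{grad}_F f,Y)$, let $\Delta_F f$ be the $g_F$-trace of $H_F^f$, and put $$Q_F^f=\Delta_F f\;g_F-H_F^f,\qquad \mathcal Q_F^f(v)=Q_F^f(v,v).$$ Let $T$ be the energy-momentum tensor on $M$ given by the Einstein equation $\mathrm{Ric}-\tfrac12\tau g=8\pi T$, where $\mathrm{Ric}$ and $\tau$ are the Ricci tensor and the scalar curvature of $(M,g)$. 1. If the quadratic forms of $\mathrm{Ric}_F$ and of $Q_F^f$ are both positive semidefinite (respectively both negative semidefinite) at every point of $F$, then $T(w,w)\ge 0$ (respectively $T(w,w)\le 0$) for every causal tangent vector $w$ of $M$, i.e. every $w$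 with $g(w,w)\le 0$. 2. If $(F,g_F)$ is Ricci flat, then for every $(t,x)\in M$, $u\in T_tI$ and $v\in T_xF$, $$8\pi\,T(u+v,u+v)=\frac1{f(x)}\,\mathcal Q_F^f(v),$$ where $u+v\in T_{(t,x)}M\cong T_tI\oplus T_xF$. Consequently $\mathcal Q_F^f$ is positive semidefinite at every point of $F$ if and only if $T(w,w)\ge 0$ for every tangent vector $w$ of $M$. -/

import Mathlib

set_option maxSynthPendingDepth 3

open scoped Manifold ContDiff

noncomputable section

namespace StaticSpacetime

/-! ### Pseudo-Riemannian geometry in a finite-dimensional vector space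

`G : E → E →L[ℝ] E →L[ℝ] ℝ` is a field of (symmetric, nondegenerate) bilinear forms, `G x u v`
being the metric at `x` of the constant vector fields `u`, `v`. -/

section Coordinates

variable {E : Type*} [NormedAddCommGroup E] [NormedSpace ℝ E]

/-- The trilinear form `(u, v, w) ↦ ∂_w G(u, v)` at `x`. -/
def derivLast (G : E → E →L[ℝ] E →L[ℝ] ℝ) (x : E) : E →L[ℝ] E →L[ℝ] E →L[ℝ] ℝ :=
  ((ContinuousLinearMap.flipₗᵢ ℝ E E ℝ).toContinuousLinearEquiv :
    (E →L[ℝ] E →L[ℝ] ℝ) →L[ℝ] (E →L[ℝ] E →L[ℝ] ℝ)).comp (fderiv ℝ G x).flip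

/-- Christoffel symbols of the first kind: the trilinear form
`(u, v, w) ↦ (∂_u G(v, w) + ∂_v G(u, w) - ∂_w G(u, v)) / 2` at `x`. -/
def christoffelFirst (G : E → E →L[ℝ] E →L[ℝ] ℝ) (x : E) : E →L[ℝ] E →L[ℝ] E →L[ℝ] ℝ :=
  (1 / 2 : ℝ) • (fderiv ℝ G x + (fderiv ℝ G x).flip - derivLast G x)

/-- Raising an index: the inverse of the isomorphism `v ↦ G x v ·` from `E` to its dual. -/
def sharp (G : E → E →L[ℝ] E →L[ℝ] ℝ) (x : E) : (E →L[ℝ] ℝ) →L[ℝ] E :=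
  (G x).inverse

/-- The Levi-Civita connection: `christoffel G x u v = Γ_x(u, v)` is the covariant derivative of
the constant field `v` in the direction `u`, i.e. the vector with
`G x (Γ_x(u, v)) w = (∂_u G(v, w) + ∂_v G(u, w) - ∂_w G(u, v)) / 2` for all `w`. -/
def christoffel (G : E → E →L[ℝ] E →L[ℝ] ℝ) (x : E) : E →L[ℝ] E →L[ℝ] E :=
  (ContinuousLinearMap.compL ℝ E (E →L[ℝ] ℝ) E (sharp G x)).comp (christoffelFirst G x)

/-- The covariant derivative at `x` of the vector field `Z`, as the endomorphism `u ↦ ∇_u Z`. -/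
def covDeriv (G : E → E →L[ℝ] E →L[ℝ] ℝ) (Z : E → E) (x : E) : E →L[ℝ] E :=
  fderiv ℝ Z x + (christoffel G x).flip (Z x)

/-- The Riemann curvature at `x`, as the endomorphism `u ↦ R(u, v) w`, where
`R(u, v) w = ∇_u ∇_v w - ∇_v ∇_u w` for constant fields `u`, `v`, `w`, that is
`R(u, v) w = (∂_u Γ)(v, w) - (∂_v Γ)(u, w) + Γ(u, Γ(v, w)) - Γ(v, Γ(u, w))`. -/
def curvature (G : E → E →L[ℝ] E →L[ℝ] ℝ) (x : E) (v w : E) : E →L[ℝ] E :=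
  ((fderiv ℝ (christoffel G) x).flip v).flip w - (fderiv ℝ (christoffel G) x v).flip w
    + (christoffel G x).flip (christoffel G x v w)
    - (christoffel G x v).comp ((christoffel G x).flip w)

/-- The Ricci tensor at `x`: `Ric(v, w)` is the trace of `u ↦ R(u, v) w`. -/
def ricciCoord (G : E → E →L[ℝ] E →L[ℝ] ℝ) (x : E) : E →ₗ[ℝ] E →ₗ[ℝ] ℝ :=
  LinearMap.mk₂ ℝ (fun v w => LinearMap.trace ℝ E (curvature G x v w : E →ₗ[ℝ] E))
    (fun v v' w => by
      rw [← map_add]; congr 1; ext u; simp [curvature]; abel)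
    (fun c v w => by
      rw [← map_smul]; congr 1; ext u; simp [curvature, smul_sub, smul_add])
    (fun v w w' => by
      rw [← map_add]; congr 1; ext u; simp [curvature]; abel)
    (fun c v w => by
      rw [← map_smul]; congr 1; ext u; simp [curvature, smul_sub, smul_add])

/-- The metric trace at `x` of a bilinear form `B`: the trace of the endomorphism `A` with
`G x (A u) v = B u v`. -/
def metricTrace [FiniteDimensional ℝ E] (G : E → E →L[ℝ] E →L[ℝ] ℝ) (x : E)
    (B : E →ₗ[ℝ] E →ₗ[ℝ] ℝ) : ℝ :=
  LinearMap.trace ℝ E ((sharp G x : (E →L[ℝ] ℝ) →ₗ[ℝ] E) ∘ₗ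
    (LinearMap.toContinuousLinearMap : (E →ₗ[ℝ] ℝ) ≃ₗ[ℝ] (E →L[ℝ] ℝ)).toLinearMap ∘ₗ B)

/-- The gradient of the function `h`: `G x (grad h) v = ∂_v h`. -/
def gradient (G : E → E →L[ℝ] E →L[ℝ] ℝ) (h : E → ℝ) (x : E) : E :=
  sharp G x (fderiv ℝ h x)

/-- The Hessian of `h` at `x`: `H(u, v) = G(∇_u grad h, v)`. -/
def hessianCoord (G : E → E →L[ℝ] E →L[ℝ] ℝ) (h : E → ℝ) (x : E) : E →ₗ[ℝ] E →ₗ[ℝ] ℝ :=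
  (ContinuousLinearMap.coeLM ℝ).comp
    ((G x).comp (covDeriv G (gradient G h) x) : E →ₗ[ℝ] E →L[ℝ] ℝ)

end Coordinates

/-! ### Pseudo-Riemannian geometry on a manifold -/

section Manifold

variable {E : Type*} [NormedAddCommGroup E] [NormedSpace ℝ E]
  {H : Type*} [TopologicalSpace H] (I : ModelWithCorners ℝ E H)
  {M : Type*} [TopologicalSpace M] [ChartedSpace H M]

/-- Fields of continuous bilinear forms on the tangent spaces. -/
abbrev MetricField : Type _ :=
  ∀ p : M, TangentSpace I p →L[ℝ] TangentSpace I p →L[ℝ] ℝ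

/-- The pullback `(u, v) ↦ B (A u, A v)` of the bilinear form `B` on `W` under `A : V → W`. -/
def pullbackForm {V W : Type*} [AddCommGroup V] [Module ℝ V] [TopologicalSpace V]
    [IsTopologicalAddGroup V] [ContinuousSMul ℝ V]
    [AddCommGroup W] [Module ℝ W] [TopologicalSpace W]
    (B : W →L[ℝ] W →L[ℝ] ℝ) (A : V →L[ℝ] W) : V →L[ℝ] V →L[ℝ] ℝ :=
  (ContinuousLinearMap.precomp ℝ A).comp (B.comp A)

/-- The metric in the preferred chart `φ` at `p`: the pullback of `g` under `φ⁻¹`, so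
`metricInChart I g p y u v = g (d(φ⁻¹)_y u, d(φ⁻¹)_y v)`. -/
def metricInChart (g : MetricField I (M := M)) (p : M) (y : E) : E →L[ℝ] E →L[ℝ] ℝ :=
  pullbackForm (g ((extChartAt I p).symm y))
    (mfderivWithin 𝓘(ℝ, E) I (extChartAt I p).symm (Set.range I) y)

/-- The differential at `p` of the preferred chart at `p`, as a linear map. -/
def chartDifferential (p : M) : TangentSpace I p →ₗ[ℝ] E :=
  (mfderiv I 𝓘(ℝ, E) (extChartAt I p) p : TangentSpace I p →L[ℝ] E).toLinearMap

/-- The Ricci tensor of `g` at `p`. -/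
def ricci (g : MetricField I (M := M)) (p : M) :
    TangentSpace I p →ₗ[ℝ] TangentSpace I p →ₗ[ℝ] ℝ :=
  (ricciCoord (metricInChart I g p) (extChartAt I p p)).compl₁₂
    (chartDifferential I p) (chartDifferential I p)

/-- The scalar curvature of `g` at `p`: the metric trace of the Ricci tensor. -/
def scalarCurvature [FiniteDimensional ℝ E] (g : MetricField I (M := M)) (p : M) : ℝ :=
  metricTrace (metricInChart I g p) (extChartAt I p p)
    (ricciCoord (metricInChart I g p) (extChartAt I p p))

/-- The Hessian of the function `f` at `p`. -/
def hessian (g : MetricField I (M := M)) (f : M → ℝ) (p : M) :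
    TangentSpace I p →ₗ[ℝ] TangentSpace I p →ₗ[ℝ] ℝ :=
  (hessianCoord (metricInChart I g p) (f ∘ (extChartAt I p).symm) (extChartAt I p p)).compl₁₂
    (chartDifferential I p) (chartDifferential I p)

/-- The Laplace-Beltrami operator: the metric trace of the Hessian. -/
def laplacian [FiniteDimensional ℝ E] (g : MetricField I (M := M)) (f : M → ℝ) (p : M) : ℝ :=
  metricTrace (metricInChart I g p) (extChartAt I p p)
    (hessianCoord (metricInChart I g p) (f ∘ (extChartAt I p).symm) (extChartAt I p p))

/-- The tensor `Q^f = Δf g - H^f`, evaluated on `v`, `w`. -/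
def tensorQ [FiniteDimensional ℝ E] (g : MetricField I (M := M)) (f : M → ℝ) (p : M)
    (v w : TangentSpace I p) : ℝ :=
  laplacian I g f p * g p v w - hessian I g f p v w

/-- The Einstein equation `Ric - (1/2) τ g = 8 π T`. -/
def EinsteinEquation [FiniteDimensional ℝ E] (g : MetricField I (M := M))
    (T : ∀ p : M, TangentSpace I p →ₗ[ℝ] TangentSpace I p →ₗ[ℝ] ℝ) : Prop :=
  ∀ (p : M) (v w : TangentSpace I p),
    ricci I g p v w - 1 / 2 * scalarCurvature I g p * g p v w = 8 * Real.pi * T p v w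

end Manifold

/-! ### Standard static space-times -/

/-- The open interval `(t₁, t₂)`, with possibly infinite end points, as an open submanifold
of `ℝ`. -/
def timeInterval (t₁ t₂ : EReal) : TopologicalSpace.Opens ℝ :=
  ⟨{t : ℝ | t₁ < (t : EReal) ∧ (t : EReal) < t₂},
    isOpen_Ioo.preimage continuous_coe_real_ereal⟩

section Static

variable {E : Type*} [NormedAddCommGroup E] [NormedSpace ℝ E]
  {F : Type*} [TopologicalSpace F] [ChartedSpace E F] (J : TopologicalSpace.Opens ℝ)

/-- The form `dt` on `J × F`, the differential of the function `(t, x) ↦ t`. -/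
def dt (q : J × F) : TangentSpace (𝓘(ℝ, ℝ).prod 𝓘(ℝ, E)) q →L[ℝ] ℝ :=
  (mfderiv (𝓘(ℝ, ℝ).prod 𝓘(ℝ, E)) 𝓘(ℝ, ℝ) (fun z : J × F => (z.1 : ℝ)) q :
    TangentSpace (𝓘(ℝ, ℝ).prod 𝓘(ℝ, E)) q →L[ℝ] ℝ)

/-- The differential of the projection `σ : J × F → F`. -/
def dσ (q : J × F) :
    TangentSpace (𝓘(ℝ, ℝ).prod 𝓘(ℝ, E)) q →L[ℝ] TangentSpace 𝓘(ℝ, E) q.2 :=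
  mfderiv (𝓘(ℝ, ℝ).prod 𝓘(ℝ, E)) 𝓘(ℝ, E) (Prod.snd : J × F → F) q

/-- The metric `-f² dt² ⊕ g_F` on `J × F`. -/
def staticMetric (gF : MetricField 𝓘(ℝ, E) (M := F)) (f : F → ℝ) :
    MetricField (𝓘(ℝ, ℝ).prod 𝓘(ℝ, E)) (M := J × F) := fun q =>
  -(f q.2) ^ 2 • pullbackForm (ContinuousLinearMap.mul ℝ ℝ) (dt J q) + pullbackForm (gF q.2) (dσ J q)

/-- The tangent vector `u + v` of `J × F` at `(t, x)` for tangent vectors `u` of `J` at `t` and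
`v` of `F` at `x`, lifted through the inclusions of the slices `J × {x}` and `{t} × F`. -/
def tangentSum (t : J) (x : F) (u : TangentSpace 𝓘(ℝ, ℝ) t) (v : TangentSpace 𝓘(ℝ, E) x) :
    TangentSpace (𝓘(ℝ, ℝ).prod 𝓘(ℝ, E)) ((t, x) : J × F) :=
  (mfderiv 𝓘(ℝ, ℝ) (𝓘(ℝ, ℝ).prod 𝓘(ℝ, E)) (fun t' : J => ((t', x) : J × F)) t u :
      TangentSpace (𝓘(ℝ, ℝ).prod 𝓘(ℝ, E)) ((t, x) : J × F))
    + (mfderiv 𝓘(ℝ, E) (𝓘(ℝ, ℝ).prod 𝓘(ℝ, E)) (fun x' : F => ((t, x') : J × F)) x v :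
      TangentSpace (𝓘(ℝ, ℝ).prod 𝓘(ℝ, E)) ((t, x) : J × F))

end Static

end StaticSpacetime

end

/-! With w = u + v, everything rests on one formula: `8πT(w,w) = Ric_F(v,v) - ½ τ_F g(w,w) +
Q(v,v)/f`. It comes from `Ric = Ric_F - H^f/f + f Δf dt²` and `τ = τ_F - 2 Δf/f`: in `-½ τ g` the
term `(Δf/f) g` cancels `f Δf dt²` and turns `-H^f/f` into `Q/f`. On causal vectors `g(w,w) ≤ 0`,
while `τ_F`, a trace of `Ric_F` in a definite metric, inherits its sign, so all three terms have the
same sign. If `Ric_F = 0`, only `Q/f` survives.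

The curvature is computed in `ℝ × E` for `staticForm` (`christoffel_staticForm`,
`ricciCoord_staticForm`, `einstein_staticForm`). It passes to the manifold because the space-time
metric in a product chart is such a form near the point (`metricInChart_staticMetric`);
`metricTrace_nonneg` gives the sign of `τ_F`. -/

namespace StaticSpacetime

open Filter Topology

/-! ### Connection, curvature and Hessian in coordinates. -/

section Coordinates

variable {E : Type*} [NormedAddCommGroup E] [NormedSpace ℝ E]

@[simp] lemma pullbackForm_apply {V W : Type*} [AddCommGroup V] [Module ℝ V] [TopologicalSpace V]
    [IsTopologicalAddGroup V] [ContinuousSMul ℝ V]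
    [AddCommGroup W] [Module ℝ W] [TopologicalSpace W]
    (B : W →L[ℝ] W →L[ℝ] ℝ) (A : V →L[ℝ] W) (u v : V) :
    pullbackForm B A u v = B (A u) (A v) := rfl

/-- The bilinear form field `G` is a pseudo-Riemannian metric of class `C²` near `x`. -/
structure IsMetricAt (G : E → E →L[ℝ] E →L[ℝ] ℝ) (x : E) : Prop where
  contDiffAt : ContDiffAt ℝ 2 G x
  symm : ∀ᶠ y in 𝓝 x, ∀ u v, G y u v = G y v u
  invertible : (G x).IsInvertible

lemma christoffelFirst_apply (G : E → E →L[ℝ] E →L[ℝ] ℝ) (x u v w : E) :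
    christoffelFirst G x u v w
      = (fderiv ℝ G x u v w + fderiv ℝ G x v u w - fderiv ℝ G x w u v) / 2 := by
  simp [christoffelFirst, derivLast, ContinuousLinearMap.flipₗᵢ]
  ring

lemma sharp_spec {G : E → E →L[ℝ] E →L[ℝ] ℝ} {x : E} (h : (G x).IsInvertible) (ξ : E →L[ℝ] ℝ) :
    G x (sharp G x ξ) = ξ :=
  h.self_apply_inverse ξ

lemma sharp_eq_iff {G : E → E →L[ℝ] E →L[ℝ] ℝ} {x : E} (h : (G x).IsInvertible) {ξ : E →L[ℝ] ℝ}
    {v : E} : sharp G x ξ = v ↔ ∀ w, G x v w = ξ w := by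
  constructor
  · rintro rfl w
    rw [sharp_spec h]
  · intro hv
    apply h.injective
    rw [sharp_spec h]
    ext w
    exact (hv w).symm

lemma christoffel_spec {G : E → E →L[ℝ] E →L[ℝ] ℝ} {x : E} (h : (G x).IsInvertible) (u v w : E) :
    G x (christoffel G x u v) w
      = (fderiv ℝ G x u v w + fderiv ℝ G x v u w - fderiv ℝ G x w u v) / 2 := by
  rw [← christoffelFirst_apply]
  exact congrArg (fun ξ : E →L[ℝ] ℝ => ξ w) (sharp_spec h (christoffelFirst G x u v))

lemma christoffel_eq_iff {G : E → E →L[ℝ] E →L[ℝ] ℝ} {x : E} (h : (G x).IsInvertible) {u v z : E} :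
    christoffel G x u v = z ↔ ∀ w, G x z w
      = (fderiv ℝ G x u v w + fderiv ℝ G x v u w - fderiv ℝ G x w u v) / 2 := by
  simp only [← christoffelFirst_apply]
  exact sharp_eq_iff h

/-- Evaluation at fixed vectors is linear, so derivatives of metrics and Christoffel symbols can be
computed on components. -/
lemma fderiv_apply_apply {E₁ E₂ E₃ : Type*} [NormedAddCommGroup E₁] [NormedSpace ℝ E₁]
    [NormedAddCommGroup E₂] [NormedSpace ℝ E₂] [NormedAddCommGroup E₃] [NormedSpace ℝ E₃]
    {K : E → E₁ →L[ℝ] E₂ →L[ℝ] E₃} {x : E} (h : DifferentiableAt ℝ K x)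
    (u : E₁) (v : E₂) (w : E) : fderiv ℝ K x w u v = fderiv ℝ (fun y => K y u v) x w := by
  have h1 : HasFDerivAt (fun y => K y u v) _ x :=
    ((h.hasFDerivAt.clm_apply (hasFDerivAt_const u x)).clm_apply (hasFDerivAt_const v x))
  rw [h1.fderiv]
  simp

lemma _root_.Filter.EventuallyEq.christoffel_eq {G G' : E → E →L[ℝ] E →L[ℝ] ℝ} {x : E}
    (h : G =ᶠ[𝓝 x] G') : christoffel G x = christoffel G' x := by
  simp only [christoffel, christoffelFirst, derivLast, sharp, h.fderiv_eq, h.eq_of_nhds]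

lemma _root_.Filter.EventuallyEq.christoffel {G G' : E → E →L[ℝ] E →L[ℝ] ℝ} {x : E}
    (h : G =ᶠ[𝓝 x] G') : christoffel G =ᶠ[𝓝 x] christoffel G' :=
  h.eventuallyEq_nhds.mono fun _ hy => hy.christoffel_eq

/-- Ricci involves two derivatives of the metric, so it depends only on the germ at the point;
agreement at the point alone would not suffice. -/
lemma _root_.Filter.EventuallyEq.ricciCoord_eq {G G' : E → E →L[ℝ] E →L[ℝ] ℝ} {x : E}
    (h : G =ᶠ[𝓝 x] G') : ricciCoord G x = ricciCoord G' x := by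
  ext v w
  simp only [ricciCoord, LinearMap.mk₂_apply, curvature, h.christoffel_eq, h.christoffel.fderiv_eq]

lemma curvature_apply (G : E → E →L[ℝ] E →L[ℝ] ℝ) (x u v w : E) :
    curvature G x v w u = fderiv ℝ (christoffel G) x u v w - fderiv ℝ (christoffel G) x v u w
      + christoffel G x u (christoffel G x v w) - christoffel G x v (christoffel G x u w) := by
  simp [curvature]

lemma ricciCoord_apply (G : E → E →L[ℝ] E →L[ℝ] ℝ) (x v w : E) :
    ricciCoord G x v w = LinearMap.trace ℝ E (curvature G x v w : E →ₗ[ℝ] E) := rfl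

namespace IsMetricAt

variable {G : E → E →L[ℝ] E →L[ℝ] ℝ} {x : E}

lemma eventually_differentiableAt (hG : IsMetricAt G x) : ∀ᶠ y in 𝓝 x, DifferentiableAt ℝ G y :=
  (hG.contDiffAt.eventually (by simp)).mono fun _ hy => hy.differentiableAt (by simp)

lemma eventually_invertible [CompleteSpace E] (hG : IsMetricAt G x) :
    ∀ᶠ y in 𝓝 x, (G y).IsInvertible := by
  obtain ⟨e, he⟩ := hG.invertible
  have h := (ContinuousLinearEquiv.nhds e)
  rw [he] at h
  filter_upwards [hG.contDiffAt.continuousAt.eventually h] with y ⟨e', he'⟩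
  exact ⟨e', he'⟩

lemma contDiffAt_sharp [CompleteSpace E] (hG : IsMetricAt G x) : ContDiffAt ℝ 2 (sharp G) x :=
  (hG.invertible.contDiffAt_map_inverse).comp x hG.contDiffAt

lemma differentiableAt_christoffel [CompleteSpace E] (hG : IsMetricAt G x) :
    DifferentiableAt ℝ (christoffel G) x := by
  have h1 : DifferentiableAt ℝ (fderiv ℝ G) x :=
    (hG.contDiffAt.fderiv_right (m := 1) (by norm_num)).differentiableAt (by simp)
  have h2 : DifferentiableAt ℝ (sharp G) x := hG.contDiffAt_sharp.differentiableAt (by simp)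
  have hflip : DifferentiableAt ℝ (fun y => (fderiv ℝ G y).flip) x :=
    (ContinuousLinearMap.flipₗᵢ ℝ E E (E →L[ℝ] ℝ)).toContinuousLinearEquiv.differentiableAt.comp
      x h1
  unfold christoffel christoffelFirst derivLast
  refine ((ContinuousLinearMap.differentiableAt _).comp x h2).clm_comp ?_
  exact ((h1.add hflip).sub ((differentiableAt_const _).clm_comp hflip)).const_smul (1 / 2 : ℝ)

lemma differentiableAt_gradient [CompleteSpace E] (hG : IsMetricAt G x) {h : E → ℝ}
    (hh : ContDiffAt ℝ 2 h x) : DifferentiableAt ℝ (gradient G h) x :=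
  (hG.contDiffAt_sharp.differentiableAt (by simp)).clm_apply
    ((hh.fderiv_right (m := 1) (by norm_num)).differentiableAt (by simp))

lemma fderiv_symm (hG : IsMetricAt G x) (u v w : E) :
    fderiv ℝ G x w u v = fderiv ℝ G x w v u := by
  have hd := hG.eventually_differentiableAt.self_of_nhds
  rw [fderiv_apply_apply hd, fderiv_apply_apply hd]
  have : (fun y => G y u v) =ᶠ[𝓝 x] fun y => G y v u := hG.symm.mono fun y hy => hy u v
  rw [this.fderiv_eq]

/-- `H(v, w) = ∂_v ∂_w h - dh (Γ(v, w))`. -/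
lemma hessianCoord_apply [CompleteSpace E] (hG : IsMetricAt G x) {h : E → ℝ}
    (hh : ContDiffAt ℝ 2 h x) (v w : E) :
    hessianCoord G h x v w
      = fderiv ℝ (fderiv ℝ h) x v w - fderiv ℝ h x (christoffel G x v w) := by
  have hd := hG.eventually_differentiableAt.self_of_nhds
  have hgrad := hG.differentiableAt_gradient hh
  have hH : hessianCoord G h x v w
      = G x (fderiv ℝ (gradient G h) x v) w + G x (christoffel G x v (gradient G h x)) w := by
    simp [hessianCoord, covDeriv]
  -- The identity `G(grad h, ·) = dh` holds near `x`, so it may be differentiated by the product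
  -- rule.
  have key : (fun y => G y (gradient G h y)) =ᶠ[𝓝 x] fderiv ℝ h :=
    hG.eventually_invertible.mono fun y hy => sharp_spec hy _
  have h1 := (hd.hasFDerivAt.clm_apply hgrad.hasFDerivAt).fderiv
  rw [key.fderiv_eq] at h1
  have h2 : fderiv ℝ (fderiv ℝ h) x v w
      = fderiv ℝ G x v (gradient G h x) w + G x (fderiv ℝ (gradient G h) x v) w := by
    rw [h1]; simp [add_comm]
  have h3 : fderiv ℝ h x (christoffel G x v w) = G x (christoffel G x v w) (gradient G h x) := by
    rw [hG.symm.self_of_nhds]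
    exact (congrArg (fun ξ : E →L[ℝ] ℝ => ξ _) key.self_of_nhds).symm
  rw [hH, h2, h3, christoffel_spec hG.invertible, christoffel_spec hG.invertible,
    hG.fderiv_symm (gradient G h x) w v]
  ring

/-- The metric trace of the Hessian is the divergence of the gradient. -/
lemma metricTrace_hessianCoord [FiniteDimensional ℝ E] (hG : IsMetricAt G x) (h : E → ℝ) :
    metricTrace G x (hessianCoord G h x)
      = LinearMap.trace ℝ E (covDeriv G (gradient G h) x : E →ₗ[ℝ] E) := by
  unfold metricTrace
  congr 1
  ext v
  refine (sharp_eq_iff hG.invertible).2 fun w => ?_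
  rfl

end IsMetricAt

end Coordinates

/-! ### Signs of metric traces, and the connection of a static metric. -/

section Coordinates

variable {E : Type*} [NormedAddCommGroup E] [NormedSpace ℝ E]

/-- A positive definite bilinear form on a finite-dimensional space is nondegenerate. -/
lemma isInvertible_of_posDef [FiniteDimensional ℝ E] {B : E →L[ℝ] E →L[ℝ] ℝ}
    (hpos : ∀ v, v ≠ 0 → 0 < B v v) : B.IsInvertible := by
  have hinj : Function.Injective ((ContinuousLinearMap.coeLM ℝ : (E →L[ℝ] ℝ) →ₗ[ℝ] _) ∘ₗ
      (B : E →ₗ[ℝ] E →L[ℝ] ℝ)) := by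
    refine (injective_iff_map_eq_zero _).2 fun v hv => ?_
    by_contra h
    have := congrArg (fun ξ : E →ₗ[ℝ] ℝ => ξ v) hv
    exact (hpos v h).ne' (by simpa using this)
  have hinj' : Function.Injective (B : E →ₗ[ℝ] E →L[ℝ] ℝ) := fun a b h =>
    hinj (by simpa using congrArg (ContinuousLinearMap.coeLM ℝ) h)
  have hdim : Module.finrank ℝ E = Module.finrank ℝ (E →L[ℝ] ℝ) := by
    rw [← (LinearMap.toContinuousLinearMap : (E →ₗ[ℝ] ℝ) ≃ₗ[ℝ] (E →L[ℝ] ℝ)).finrank_eq]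
    exact Subspace.dual_finrank_eq.symm
  let e := LinearEquiv.ofInjectiveOfFinrankEq (B : E →ₗ[ℝ] E →L[ℝ] ℝ) hinj' hdim
  exact ⟨e.toContinuousLinearEquiv, by ext; rfl⟩

lemma metricTrace_add [FiniteDimensional ℝ E] (G : E → E →L[ℝ] E →L[ℝ] ℝ) (x : E)
    (B B' : E →ₗ[ℝ] E →ₗ[ℝ] ℝ) :
    metricTrace G x (B + B') = metricTrace G x B + metricTrace G x B' := by
  simp only [metricTrace, LinearMap.comp_add, map_add]

lemma metricTrace_smul [FiniteDimensional ℝ E] (G : E → E →L[ℝ] E →L[ℝ] ℝ) (x : E)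
    (c : ℝ) (B : E →ₗ[ℝ] E →ₗ[ℝ] ℝ) :
    metricTrace G x (c • B) = c * metricTrace G x B := by
  simp only [metricTrace, LinearMap.comp_smul, map_smul, smul_eq_mul]

/-- The trace of a positive semidefinite form with respect to a positive definite metric is
nonnegative. -/
lemma metricTrace_nonneg [FiniteDimensional ℝ E] {G : E → E →L[ℝ] E →L[ℝ] ℝ} {x : E}
    (hsymm : ∀ u v, G x u v = G x v u) (hpos : ∀ v, v ≠ 0 → 0 < G x v v)
    {B : E →ₗ[ℝ] E →ₗ[ℝ] ℝ} (hB : ∀ v, 0 ≤ B v v) : 0 ≤ metricTrace G x B := by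
  classical
  let g : LinearMap.BilinForm ℝ E := (ContinuousLinearMap.coeLM ℝ).comp (G x : E →ₗ[ℝ] E →L[ℝ] ℝ)
  have hg : LinearMap.IsSymm g := ⟨fun u v => hsymm u v⟩
  -- In an orthogonal basis the trace is the sum of `B(bᵢ, bᵢ) / G(bᵢ, bᵢ)`; normalising the basis
  -- is unnecessary.
  obtain ⟨b, hb⟩ := LinearMap.BilinForm.exists_orthogonal_basis hg
  have hbpos : ∀ i, 0 < G x (b i) (b i) := fun i => hpos _ (b.ne_zero i)
  have hrepr : ∀ v i, b.repr v i = G x v (b i) / G x (b i) (b i) := by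
    intro v i
    rw [eq_div_iff (hbpos i).ne']
    conv_rhs => rw [← b.sum_repr v]
    rw [map_sum, sum_apply, Finset.sum_eq_single i]
    · simp
    · intro j _ hj
      have : G x (b j) (b i) = 0 := hb hj
      simp [this]
    · simp
  unfold metricTrace
  rw [LinearMap.trace_eq_matrix_trace ℝ b, Matrix.trace]
  refine Finset.sum_nonneg fun i _ => ?_
  rw [Matrix.diag_apply, LinearMap.toMatrix_apply, hrepr]
  refine div_nonneg ?_ (hbpos i).le
  have h := sharp_spec (isInvertible_of_posDef hpos) (LinearMap.toContinuousLinearMap (B (b i)))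
  have h' := congrArg (fun ξ : E →L[ℝ] ℝ => ξ (b i)) h
  simp only [LinearMap.coe_toContinuousLinearMap'] at h'
  exact (hB (b i)).trans_eq h'.symm

lemma metricTrace_nonpos [FiniteDimensional ℝ E] {G : E → E →L[ℝ] E →L[ℝ] ℝ} {x : E}
    (hsymm : ∀ u v, G x u v = G x v u) (hpos : ∀ v, v ≠ 0 → 0 < G x v v)
    {B : E →ₗ[ℝ] E →ₗ[ℝ] ℝ} (hB : ∀ v, B v v ≤ 0) : metricTrace G x B ≤ 0 := by
  have h := metricTrace_nonneg (B := (-1 : ℝ) • B) hsymm hpos fun v => by simpa using hB v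
  rw [metricTrace_smul] at h
  linarith

/-- The trace of an endomorphism of a product is the sum of the traces of its diagonal blocks. -/
lemma trace_prod {V W : Type*} [AddCommGroup V] [Module ℝ V] [FiniteDimensional ℝ V]
    [AddCommGroup W] [Module ℝ W] [FiniteDimensional ℝ W] (A : V × W →ₗ[ℝ] V × W) :
    LinearMap.trace ℝ (V × W) A
      = LinearMap.trace ℝ V (LinearMap.fst ℝ V W ∘ₗ A ∘ₗ LinearMap.inl ℝ V W)
        + LinearMap.trace ℝ W (LinearMap.snd ℝ V W ∘ₗ A ∘ₗ LinearMap.inr ℝ V W) := by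
  -- Split the identity as `inl ∘ fst + inr ∘ snd`; cyclicity of the trace then moves each
  -- projection to the front.
  have h : A = (A ∘ₗ LinearMap.inl ℝ V W) ∘ₗ LinearMap.fst ℝ V W
      + (A ∘ₗ LinearMap.inr ℝ V W) ∘ₗ LinearMap.snd ℝ V W := by
    refine LinearMap.ext fun ⟨v, w⟩ => ?_
    simp [← map_add]
  conv_lhs => rw [h]
  rw [map_add, LinearMap.trace_comp_comm', LinearMap.trace_comp_comm' (LinearMap.snd ℝ V W)]

lemma trace_real (A : ℝ →ₗ[ℝ] ℝ) : LinearMap.trace ℝ ℝ A = A 1 := by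
  rw [LinearMap.trace_eq_matrix_trace ℝ (Module.Basis.singleton Unit ℝ)]
  simp [Matrix.trace, LinearMap.toMatrix_apply]

/-- The bilinear form `-h² dt² ⊕ G` on `ℝ × E`. -/
noncomputable def staticForm (G : E → E →L[ℝ] E →L[ℝ] ℝ) (h : E → ℝ) (z : ℝ × E) :
    ℝ × E →L[ℝ] ℝ × E →L[ℝ] ℝ :=
  -(h z.2) ^ 2 • pullbackForm (ContinuousLinearMap.mul ℝ ℝ) (ContinuousLinearMap.fst ℝ ℝ E)
    + pullbackForm (G z.2) (ContinuousLinearMap.snd ℝ ℝ E)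

lemma staticForm_apply (G : E → E →L[ℝ] E →L[ℝ] ℝ) (h : E → ℝ) (z U V : ℝ × E) :
    staticForm G h z U V = -(h z.2) ^ 2 * (U.1 * V.1) + G z.2 U.2 V.2 := by
  simp [staticForm]

variable {G : E → E →L[ℝ] E →L[ℝ] ℝ} {h : E → ℝ}

/-- The coefficients do not depend on time, so `W.1` drops out. -/
lemma fderiv_staticForm {z : ℝ × E} (hG : DifferentiableAt ℝ G z.2)
    (hh : DifferentiableAt ℝ h z.2) (U V W : ℝ × E) :
    fderiv ℝ (staticForm G h) z W U V
      = -2 * h z.2 * fderiv ℝ h z.2 W.2 * (U.1 * V.1) + fderiv ℝ G z.2 W.2 U.2 V.2 := by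
  have h1 : HasFDerivAt (fun y : ℝ × E => h y.2) _ z :=
    hh.hasFDerivAt.comp z (hasFDerivAt_snd (𝕜 := ℝ) (E := ℝ) (F := E))
  have h2 : HasFDerivAt (fun y : ℝ × E => G y.2) _ z :=
    hG.hasFDerivAt.comp z (hasFDerivAt_snd (𝕜 := ℝ) (E := ℝ) (F := E))
  have hd : DifferentiableAt ℝ (staticForm G h) z := by
    unfold staticForm pullbackForm
    refine ((h1.differentiableAt.pow 2).neg.smul_const _).add ?_
    exact (differentiableAt_const _).clm_comp
      (h2.differentiableAt.clm_comp (differentiableAt_const _))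
  rw [fderiv_apply_apply hd]
  simp only [staticForm_apply]
  have h3 := ((h1.pow 2).neg.mul_const (U.1 * V.1)).add
    ((h2.clm_apply (hasFDerivAt_const U.2 z)).clm_apply (hasFDerivAt_const V.2 z))
  refine (congrArg (fun ξ => ξ W) h3.fderiv).trans ?_
  simp
  ring

/-- A static metric is nondegenerate. -/
lemma isInvertible_staticForm {z : ℝ × E} (hG : (G z.2).IsInvertible) (hh : h z.2 ≠ 0) :
    (staticForm G h z).IsInvertible := by
  -- The form is block diagonal, hence so is its inverse: `-1/h²` on the time axis and `sharp G` on
  -- `E`.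
  let S : (ℝ × E →L[ℝ] ℝ) →L[ℝ] ℝ × E :=
    ((-((h z.2) ^ 2)⁻¹) • (ContinuousLinearMap.apply ℝ ℝ ((1 : ℝ), (0 : E)))).prod
      ((sharp G z.2).comp
        (ContinuousLinearMap.precomp ℝ (ContinuousLinearMap.inr ℝ ℝ E)))
  refine ContinuousLinearMap.IsInvertible.of_inverse (g := S) ?_ ?_
  · ext ξ W
    · simp [S, staticForm_apply]
      field_simp
    · simp [S, staticForm_apply, sharp_spec hG]
  · have hS : ∀ U, S (staticForm G h z U) = U := by
      intro U
      refine Prod.ext ?_ ?_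
      · simp [S, staticForm_apply]
        field_simp
      · refine (sharp_eq_iff hG).2 fun w => ?_
        simp [staticForm_apply]
    ext U <;> simp [hS]

/-- Nondegeneracy reduces this to checking the Koszul formula against every `U`. The terms beyond
`christoffel G` come from differentiating `-h²`. -/
lemma christoffel_staticForm {z : ℝ × E} (hG : DifferentiableAt ℝ G z.2)
    (hinv : (G z.2).IsInvertible)
    (hh : DifferentiableAt ℝ h z.2) (h0 : h z.2 ≠ 0) (V W : ℝ × E) :
    christoffel (staticForm G h) z V W
      = (V.1 * (fderiv ℝ h z.2 W.2 / h z.2) + W.1 * (fderiv ℝ h z.2 V.2 / h z.2),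
        christoffel G z.2 V.2 W.2 + (V.1 * W.1 * h z.2) • gradient G h z.2) := by
  refine (christoffel_eq_iff (isInvertible_staticForm hinv h0)).2 fun U => ?_
  have hgrad : G z.2 (gradient G h z.2) U.2 = fderiv ℝ h z.2 U.2 := by
    rw [gradient, sharp_spec hinv]
  simp only [staticForm_apply, fderiv_staticForm hG hh, map_add, map_smul,
    add_apply, smul_apply, smul_eq_mul, hgrad,
    christoffel_spec hinv]
  field_simp
  ring

end Coordinates

/-! ### Ricci, scalar and Einstein curvature of a static metric. -/

section Coordinates

variable {E : Type*} [NormedAddCommGroup E] [NormedSpace ℝ E]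
  {G : E → E →L[ℝ] E →L[ℝ] ℝ} {h : E → ℝ} {z : ℝ × E}

lemma IsMetricAt.staticForm (hG : IsMetricAt G z.2) (hh : ContDiffAt ℝ 2 h z.2)
    (h0 : h z.2 ≠ 0) : IsMetricAt (staticForm G h) z where
  contDiffAt := by
    have h1 : ContDiffAt ℝ 2 (fun y : ℝ × E => h y.2) z := hh.comp z contDiffAt_snd
    have h2 : ContDiffAt ℝ 2 (fun y : ℝ × E => G y.2) z := hG.contDiffAt.comp z contDiffAt_snd
    unfold StaticSpacetime.staticForm pullbackForm
    refine ((h1.pow 2).neg.smul contDiffAt_const).add ?_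
    exact contDiffAt_const.clm_comp (h2.clm_comp contDiffAt_const)
  symm := by
    have : Tendsto Prod.snd (𝓝 z) (𝓝 z.2) := continuousAt_snd
    filter_upwards [this.eventually hG.symm] with y hy u v
    rw [staticForm_apply, staticForm_apply, hy, mul_comm u.1]
  invertible := isInvertible_staticForm hG.invertible h0

section Complete

variable [CompleteSpace E]

/-- Curvature differentiates the Christoffel symbols, so their formula is needed on a neighbourhood.
-/
lemma eventually_christoffel_staticForm (hG : IsMetricAt G z.2) (hh : ContDiffAt ℝ 2 h z.2)
    (h0 : h z.2 ≠ 0) (V W : ℝ × E) :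
    ∀ᶠ y in 𝓝 z, christoffel (staticForm G h) y V W
      = (V.1 * (fderiv ℝ h y.2 W.2 / h y.2) + W.1 * (fderiv ℝ h y.2 V.2 / h y.2),
        christoffel G y.2 V.2 W.2 + (V.1 * W.1 * h y.2) • gradient G h y.2) := by
  have hsnd : Tendsto Prod.snd (𝓝 z) (𝓝 z.2) := continuousAt_snd
  have hd : ∀ᶠ y in 𝓝 z.2, DifferentiableAt ℝ h y :=
    (hh.eventually (by simp)).mono fun _ hy => hy.differentiableAt (by simp)
  filter_upwards [hsnd.eventually hG.eventually_differentiableAt,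
    hsnd.eventually hG.eventually_invertible, hsnd.eventually hd,
    hsnd.eventually (hh.continuousAt.eventually_ne h0)] with y h1 h2 h3 h4
  exact christoffel_staticForm h1 h2 h3 h4 V W

lemma fderiv_christoffel_staticForm (hG : IsMetricAt G z.2) (hh : ContDiffAt ℝ 2 h z.2)
    (h0 : h z.2 ≠ 0) (hd : DifferentiableAt ℝ (christoffel (staticForm G h)) z) (U V W : ℝ × E) :
    fderiv ℝ (christoffel (staticForm G h)) z U V W
      = (V.1 * (fderiv ℝ (fderiv ℝ h) z.2 U.2 W.2 / h z.2
              - fderiv ℝ h z.2 U.2 * fderiv ℝ h z.2 W.2 / h z.2 ^ 2)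
          + W.1 * (fderiv ℝ (fderiv ℝ h) z.2 U.2 V.2 / h z.2
              - fderiv ℝ h z.2 U.2 * fderiv ℝ h z.2 V.2 / h z.2 ^ 2),
        fderiv ℝ (christoffel G) z.2 U.2 V.2 W.2
          + (V.1 * W.1) • (fderiv ℝ h z.2 U.2 • gradient G h z.2
              + h z.2 • fderiv ℝ (gradient G h) z.2 U.2)) := by
  have hsnd := hasFDerivAt_snd (𝕜 := ℝ) (E := ℝ) (F := E) (p := z)
  have h1 : HasFDerivAt (fun y : ℝ × E => h y.2) _ z :=
    (hh.differentiableAt (by simp)).hasFDerivAt.comp z hsnd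
  have h2 : HasFDerivAt (fun y : ℝ × E => fderiv ℝ h y.2) _ z :=
    ((hh.fderiv_right (m := 1) (by norm_num)).differentiableAt (by simp)).hasFDerivAt.comp z hsnd
  have h3 : HasFDerivAt (fun y : ℝ × E => christoffel G y.2) _ z :=
    hG.differentiableAt_christoffel.hasFDerivAt.comp z hsnd
  have h4 : HasFDerivAt (fun y : ℝ × E => gradient G h y.2) _ z :=
    (hG.differentiableAt_gradient hh).hasFDerivAt.comp z hsnd
  have heq : (fun y => christoffel (staticForm G h) y V W) =ᶠ[𝓝 z] _ :=
    eventually_christoffel_staticForm hG hh h0 V W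
  rw [fderiv_apply_apply hd, heq.fderiv_eq]
  have hinv : HasFDerivAt (fun y : ℝ × E => (h y.2)⁻¹) _ z :=
    (hasDerivAt_inv h0).comp_hasFDerivAt z h1
  have hη := fun w : E => (h2.clm_apply (hasFDerivAt_const w z)).mul hinv
  simp only [div_eq_mul_inv]
  have h5 := (((hη W.2).const_mul V.1).add ((hη V.2).const_mul W.1)).prodMk
    (((h3.clm_apply (hasFDerivAt_const V.2 z)).clm_apply (hasFDerivAt_const W.2 z)).add
      ((h1.const_mul (V.1 * W.1)).smul h4))
  refine (congrArg (fun ξ => ξ U) h5.fderiv).trans ?_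
  refine Prod.ext ?_ ?_
  · simp
    field_simp
    ring
  · simp only [ContinuousLinearMap.prod_apply, add_apply, smul_apply]
    simp
    module

end Complete

variable [FiniteDimensional ℝ E]

/-- The trace of a form with respect to a static metric. -/
lemma metricTrace_staticForm (hinv : (G z.2).IsInvertible) (h0 : h z.2 ≠ 0)
    (B : ℝ × E →ₗ[ℝ] ℝ × E →ₗ[ℝ] ℝ) :
    metricTrace (staticForm G h) z B
      = - B (1, 0) (1, 0) / h z.2 ^ 2
        + metricTrace G z.2 (B.compl₁₂ (LinearMap.inr ℝ ℝ E) (LinearMap.inr ℝ ℝ E)) := by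
  have hsharp : ∀ ξ : ℝ × E →L[ℝ] ℝ, sharp (staticForm G h) z ξ
      = (-ξ (1, 0) / h z.2 ^ 2, sharp G z.2 (ξ.comp (ContinuousLinearMap.inr ℝ ℝ E))) := by
    intro ξ
    refine (sharp_eq_iff (isInvertible_staticForm hinv h0)).2 fun U => ?_
    have hU : U = U.1 • ((1 : ℝ), (0 : E)) + (0, U.2) := by ext <;> simp
    rw [staticForm_apply, sharp_spec hinv]
    conv_rhs => rw [hU, map_add, map_smul]
    simp
    field_simp
  unfold metricTrace
  rw [trace_prod, trace_real]
  congr 1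
  · simp [hsharp]
  · congr 1
    ext u
    simp [hsharp]
    congr 1

/-- The Ricci tensor of a static metric. -/
lemma ricciCoord_staticForm (hG : IsMetricAt G z.2) (hh : ContDiffAt ℝ 2 h z.2)
    (h0 : h z.2 ≠ 0) (V W : ℝ × E) :
    ricciCoord (staticForm G h) z V W
      = ricciCoord G z.2 V.2 W.2 - hessianCoord G h z.2 V.2 W.2 / h z.2
        + V.1 * W.1 * (h z.2 * metricTrace G z.2 (hessianCoord G h z.2)) := by
  have := FiniteDimensional.complete ℝ E
  have hd := (hG.staticForm hh h0).differentiableAt_christoffel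
  have hΓ := fun V W => (eventually_christoffel_staticForm hG hh h0 V W).self_of_nhds
  rw [ricciCoord_apply, trace_prod, trace_real]
  -- Time block of the trace: the `∂_t` component of `R(∂_t, V)W`.
  have hfst : (LinearMap.fst ℝ ℝ E ∘ₗ
      (curvature (staticForm G h) z V W : ℝ × E →ₗ[ℝ] ℝ × E) ∘ₗ LinearMap.inl ℝ ℝ E) 1
      = - hessianCoord G h z.2 V.2 W.2 / h z.2 := by
    rw [hG.hessianCoord_apply hh]
    simp [curvature_apply, hΓ, fderiv_christoffel_staticForm hG hh h0 hd]
    field_simp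
    ring
  -- Space block: the terms `dh(u) grad h` from `∂_u Γ(V, W)` and `Γ(V, Γ(u, W))` cancel, leaving
  -- `∇_u grad h`, whose trace is the Laplacian.
  have hsnd : LinearMap.snd ℝ ℝ E ∘ₗ
      (curvature (staticForm G h) z V W : ℝ × E →ₗ[ℝ] ℝ × E) ∘ₗ LinearMap.inr ℝ ℝ E
      = (curvature G z.2 V.2 W.2 : E →ₗ[ℝ] E)
        + (V.1 * W.1 * h z.2) • (covDeriv G (gradient G h) z.2 : E →ₗ[ℝ] E) := by
    ext1 u
    simp [curvature_apply, hΓ, fderiv_christoffel_staticForm hG hh h0 hd, covDeriv]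
    match_scalars <;> field_simp
    ring
  rw [hfst, hsnd, map_add, map_smul, hG.metricTrace_hessianCoord, ricciCoord_apply, smul_eq_mul]
  ring

/-- The scalar curvature of a static metric. -/
lemma metricTrace_ricciCoord_staticForm (hG : IsMetricAt G z.2) (hh : ContDiffAt ℝ 2 h z.2)
    (h0 : h z.2 ≠ 0) :
    metricTrace (staticForm G h) z (ricciCoord (staticForm G h) z)
      = metricTrace G z.2 (ricciCoord G z.2)
        - 2 * metricTrace G z.2 (hessianCoord G h z.2) / h z.2 := by
  -- The time direction contributes `-Δh/h` and the trace of `-H/h` contributes it again, whence the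
  -- factor 2.
  rw [metricTrace_staticForm hG.invertible h0, ricciCoord_staticForm hG hh h0]
  have : (ricciCoord (staticForm G h) z).compl₁₂ (LinearMap.inr ℝ ℝ E) (LinearMap.inr ℝ ℝ E)
      = ricciCoord G z.2 + (-(h z.2)⁻¹) • hessianCoord G h z.2 := by
    ext v w
    simp [ricciCoord_staticForm hG hh h0]
    ring
  rw [this, metricTrace_add, metricTrace_smul]
  simp
  field_simp
  ring

/-- The Einstein tensor of a static metric. -/
lemma einstein_staticForm (hG : IsMetricAt G z.2) (hh : ContDiffAt ℝ 2 h z.2)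
    (h0 : h z.2 ≠ 0) (V W : ℝ × E) :
    ricciCoord (staticForm G h) z V W
        - 1 / 2 * metricTrace (staticForm G h) z (ricciCoord (staticForm G h) z)
          * staticForm G h z V W
      = ricciCoord G z.2 V.2 W.2
        - 1 / 2 * metricTrace G z.2 (ricciCoord G z.2) * staticForm G h z V W
        + 1 / h z.2 * (metricTrace G z.2 (hessianCoord G h z.2) * G z.2 V.2 W.2
            - hessianCoord G h z.2 V.2 W.2) := by
  -- The scalar curvature adds `(Δh/h)(-h² dt² + G)`: its time part cancels the `dt²` term of Ricci,
  -- its space part completes `Q/h`.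
  rw [metricTrace_ricciCoord_staticForm hG hh h0, ricciCoord_staticForm hG hh h0,
    staticForm_apply]
  field_simp
  ring

end Coordinates

/-! ### Tensors at a point, read in the preferred chart. -/

section Manifold

variable {E : Type*} [NormedAddCommGroup E] [NormedSpace ℝ E]
  {H : Type*} [TopologicalSpace H] (I : ModelWithCorners ℝ E H)
  {M : Type*} [TopologicalSpace M] [ChartedSpace H M]

lemma metricInChart_apply (g : MetricField I (M := M)) (p : M) (y u v : E) :
    metricInChart I g p y u v = g ((extChartAt I p).symm y)
      (mfderivWithin 𝓘(ℝ, E) I (extChartAt I p).symm (Set.range I) y u)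
      (mfderivWithin 𝓘(ℝ, E) I (extChartAt I p).symm (Set.range I) y v) := rfl

variable [IsManifold I 1 M]

/-- The tangent space at `p` is the model space, identified through this very chart. -/
lemma chartDifferential_apply (p : M) (v : TangentSpace I p) : chartDifferential I p v = v := by
  unfold chartDifferential
  rw [mfderiv_extChartAt_self]
  rfl

lemma metricInChart_self (g : MetricField I (M := M)) (p : M) (u v : TangentSpace I p) :
    metricInChart I g p (extChartAt I p p) u v = g p u v := by
  -- The base point is `φ⁻¹(φ(p))`, equal to `p` but not by definition, so the equality is
  -- transported on the values of `g`.
  have key : ∀ p', p' = p → g p' (u : E) (v : E) = g p u v := by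
    rintro _ rfl
    rfl
  refine (metricInChart_apply I g p _ u v).trans ?_
  rw [mfderivWithin_range_extChartAt_symm]
  exact key _ (extChartAt_to_inv p)

lemma ricci_apply (g : MetricField I (M := M)) (p : M) (v w : TangentSpace I p) :
    ricci I g p v w = ricciCoord (metricInChart I g p) (extChartAt I p p) v w := by
  unfold ricci
  rw [LinearMap.compl₁₂_apply, chartDifferential_apply, chartDifferential_apply]

lemma hessian_apply (g : MetricField I (M := M)) (f : M → ℝ) (p : M) (v w : TangentSpace I p) :
    hessian I g f p v w
      = hessianCoord (metricInChart I g p) (f ∘ (extChartAt I p).symm) (extChartAt I p p) v w := by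
  unfold hessian
  rw [LinearMap.compl₁₂_apply, chartDifferential_apply, chartDifferential_apply]

end Manifold

/-! ### Regularity of the Riemannian metric in a chart. -/

section Boundaryless

variable {E : Type*} [NormedAddCommGroup E] [NormedSpace ℝ E]
  {F : Type*} [TopologicalSpace F] [ChartedSpace E F]

lemma contDiffAt_comp_extChartAt_symm [IsManifold 𝓘(ℝ, E) ∞ F] {X : Type*} [NormedAddCommGroup X]
    [NormedSpace ℝ X] {f : F → X} {x : F} (hf : ContMDiffAt 𝓘(ℝ, E) 𝓘(ℝ, X) ∞ f x) :
    ContDiffAt ℝ ∞ (f ∘ (extChartAt 𝓘(ℝ, E) x).symm) (extChartAt 𝓘(ℝ, E) x x) := by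
  have h := (contMDiffAt_iff.1 hf).2
  rw [extChartAt_model_space_eq_id, modelWithCornersSelf_coe, Set.range_id,
    contDiffWithinAt_univ] at h
  exact h

/-- Smoothness of `g` is given in bundle trivialisations, whereas the chart metric is a pullback.
They agree near the point because the inverse tangent trivialisation is the differential of the
inverse chart. -/
lemma isMetricAt_metricInChart [FiniteDimensional ℝ E] [IsManifold 𝓘(ℝ, E) ∞ F]
    (g : Bundle.ContMDiffRiemannianMetric 𝓘(ℝ, E) ∞ E
      (fun x : F => TangentSpace 𝓘(ℝ, E) x)) (x : F) :
    IsMetricAt (metricInChart 𝓘(ℝ, E) g.inner x) (extChartAt 𝓘(ℝ, E) x x) where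
  contDiffAt := by
    have h := ((contMDiffAt_hom_bundle _).1 (g.contMDiff x)).2
    have h' := contDiffAt_comp_extChartAt_symm h
    refine ContDiffAt.congr_of_eventuallyEq (h'.of_le (WithTop.coe_le_coe.2 le_top)) ?_
    filter_upwards [extChartAt_target_mem_nhds (I := 𝓘(ℝ, E)) x] with y hy
    have hy' : (extChartAt 𝓘(ℝ, E) x).symm y ∈ (chartAt E x).source := by
      rw [← extChartAt_source 𝓘(ℝ, E)]
      exact (extChartAt 𝓘(ℝ, E) x).map_target hy
    ext u v
    have hb : (extChartAt 𝓘(ℝ, E) x).symm y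
        ∈ (trivializationAt E (TangentSpace 𝓘(ℝ, E)) x).baseSet := by simpa using hy'
    have hconst : ∀ (z : E), z = y → ∀ w : E,
        (mfderivWithin 𝓘(ℝ, E) 𝓘(ℝ, E) (extChartAt 𝓘(ℝ, E) x).symm (Set.range 𝓘(ℝ, E)) z w : E)
        = mfderivWithin 𝓘(ℝ, E) 𝓘(ℝ, E) (extChartAt 𝓘(ℝ, E) x).symm (Set.range 𝓘(ℝ, E)) y w := by
      rintro _ rfl _
      rfl
    have he : ∀ w : E, (trivializationAt E (TangentSpace 𝓘(ℝ, E)) x).symm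
        ((extChartAt 𝓘(ℝ, E) x).symm y) w
        = mfderivWithin 𝓘(ℝ, E) 𝓘(ℝ, E) (extChartAt 𝓘(ℝ, E) x).symm (Set.range 𝓘(ℝ, E)) y w :=
      fun w => (Bundle.Trivialization.symmL_apply _ hb w).symm.trans <| (congrArg (fun A => A w)
        (TangentBundle.symmL_trivializationAt (I := 𝓘(ℝ, E)) hy')).trans
          (hconst _ ((extChartAt 𝓘(ℝ, E) x).right_inv hy) w)
    refine Eq.trans ?_ (inCoordinates_apply_eq₂ (F₃ := ℝ) (E₃ := fun _ : F => ℝ)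
      hb hb (Set.mem_univ _)).symm
    rw [he, he]
    exact (LinearMap.congr_fun (Bundle.Trivial.linearMapAt_trivialization ℝ F ℝ _) _).symm
  symm := .of_forall fun y u v => g.symm _ _ _
  invertible := isInvertible_of_posDef fun v hv =>
    (g.pos x v hv).trans_eq (metricInChart_self 𝓘(ℝ, E) g.inner x v v).symm

end Boundaryless

/-! ### The space-time metric in a product chart. -/

section Static

variable {E : Type*} [NormedAddCommGroup E] [NormedSpace ℝ E]
  {F : Type*} [TopologicalSpace F] [ChartedSpace E F] {J : TopologicalSpace.Opens ℝ}

lemma coe_extChartAt_opens (t : J) : ⇑(extChartAt 𝓘(ℝ, ℝ) t) = Subtype.val := rfl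

lemma mfderiv_coe_opens (t : J) :
    mfderiv 𝓘(ℝ, ℝ) 𝓘(ℝ, ℝ) (Subtype.val : J → ℝ) t = ContinuousLinearMap.id ℝ ℝ :=
  mfderiv_extChartAt_self (I := 𝓘(ℝ, ℝ)) (x := t)

lemma dt_apply (q : J × F) (w : TangentSpace (𝓘(ℝ, ℝ).prod 𝓘(ℝ, E)) q) :
    dt J q w = w.1 := by
  have h1 : MDifferentiableAt 𝓘(ℝ, ℝ) 𝓘(ℝ, ℝ) (Subtype.val : J → ℝ) q.1 :=
    (contMDiff_subtype_val (n := 1)).mdifferentiable (by simp) _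
  have h := mfderiv_comp q h1
    (mdifferentiableAt_fst (I := 𝓘(ℝ, ℝ)) (I' := 𝓘(ℝ, E)) (x := q))
  rw [mfderiv_coe_opens, mfderiv_fst] at h
  exact congrArg (fun A => A w) h

lemma dσ_apply (q : J × F) (w : TangentSpace (𝓘(ℝ, ℝ).prod 𝓘(ℝ, E)) q) :
    dσ J q w = w.2 := by
  unfold dσ
  rw [mfderiv_snd]
  rfl

lemma staticMetric_apply (gF : MetricField 𝓘(ℝ, E) (M := F)) (f : F → ℝ) (q : J × F)
    (v w : TangentSpace (𝓘(ℝ, ℝ).prod 𝓘(ℝ, E)) q) :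
    staticMetric J gF f q v w = -(f q.2) ^ 2 * (v.1 * w.1) + gF q.2 v.2 w.2 := by
  have h : staticMetric J gF f q v w
      = -(f q.2) ^ 2 * (dt J q v * dt J q w) + gF q.2 (dσ J q v) (dσ J q w) := rfl
  rw [h, dt_apply, dt_apply, dσ_apply, dσ_apply]

lemma tangentSum_eq (t : J) (x : F) (u : TangentSpace 𝓘(ℝ, ℝ) t) (v : TangentSpace 𝓘(ℝ, E) x) :
    tangentSum J t x u v = ((u, v) : ℝ × E) := by
  unfold tangentSum
  rw [mfderiv_prod_left, mfderiv_prod_right]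
  refine Prod.ext ?_ ?_
  · exact add_zero u
  · exact zero_add v

/-- The chart of `J` is the inclusion, with identity differential; the inverse chart therefore has
identity differential too. -/
lemma mfderivWithin_extChartAt_opens_symm {t : J} {r : ℝ} (hr : r ∈ (extChartAt 𝓘(ℝ, ℝ) t).target)
    (a : ℝ) : mfderivWithin 𝓘(ℝ, ℝ) 𝓘(ℝ, ℝ) (extChartAt 𝓘(ℝ, ℝ) t).symm
      (Set.range 𝓘(ℝ, ℝ)) r a = a := by
  have h := mfderiv_extChartAt_comp_mfderivWithin_extChartAt_symm hr
  have h' := congrArg (fun A => A a) h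
  have h2 := mfderiv_coe_opens ((extChartAt 𝓘(ℝ, ℝ) t).symm r)
  rw [coe_extChartAt_opens] at h'
  erw [h2] at h'
  exact h'

/-- The chart at `q` is a product of charts, so the differential of its inverse is block diagonal
with identity time block. Equality of germs is what the curvature requires. -/
lemma metricInChart_staticMetric [IsManifold 𝓘(ℝ, E) 1 F]
    (gF : MetricField 𝓘(ℝ, E) (M := F)) (f : F → ℝ) (q : J × F) :
    metricInChart (𝓘(ℝ, ℝ).prod 𝓘(ℝ, E)) (staticMetric J gF f) q
      =ᶠ[𝓝 (extChartAt (𝓘(ℝ, ℝ).prod 𝓘(ℝ, E)) q q)]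
      staticForm (metricInChart 𝓘(ℝ, E) gF q.2) (f ∘ (extChartAt 𝓘(ℝ, E) q.2).symm) := by
  filter_upwards [extChartAt_target_mem_nhds (I := 𝓘(ℝ, ℝ).prod 𝓘(ℝ, E)) q] with y hy
  have hsymm : ⇑(extChartAt (𝓘(ℝ, ℝ).prod 𝓘(ℝ, E)) q).symm
      = Prod.map (extChartAt 𝓘(ℝ, ℝ) q.1).symm (extChartAt 𝓘(ℝ, E) q.2).symm := by
    rw [extChartAt_prod]; rfl
  rw [extChartAt_prod, PartialEquiv.prod_target] at hy
  have h1 := mdifferentiableWithinAt_extChartAt_symm (I := 𝓘(ℝ, ℝ)) hy.1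
  have h2 := mdifferentiableWithinAt_extChartAt_symm (I := 𝓘(ℝ, E)) hy.2
  have hd := mfderivWithin_prodMap h1 h2 (by simp [uniqueMDiffWithinAt_univ])
    (by simp [uniqueMDiffWithinAt_univ])
  have hrange : Set.range (𝓘(ℝ, ℝ).prod 𝓘(ℝ, E))
      = Set.range 𝓘(ℝ, ℝ) ×ˢ Set.range 𝓘(ℝ, E) := by simp
  have hA : ∀ U : ℝ × E, mfderivWithin 𝓘(ℝ, ℝ × E) (𝓘(ℝ, ℝ).prod 𝓘(ℝ, E))
      (extChartAt (𝓘(ℝ, ℝ).prod 𝓘(ℝ, E)) q).symm (Set.range (𝓘(ℝ, ℝ).prod 𝓘(ℝ, E))) y U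
      = ((U.1, mfderivWithin 𝓘(ℝ, E) 𝓘(ℝ, E) (extChartAt 𝓘(ℝ, E) q.2).symm
          (Set.range 𝓘(ℝ, E)) y.2 U.2) : ℝ × E) := by
    intro U
    rw [hsymm, hrange, modelWithCornersSelf_prod, ← chartedSpaceSelf_prod]
    refine (congrArg (fun A => A U) hd).trans ?_
    refine Prod.ext ?_ rfl
    exact mfderivWithin_extChartAt_opens_symm hy.1 U.1
  refine ContinuousLinearMap.ext fun U => ContinuousLinearMap.ext fun V => ?_
  refine ((metricInChart_apply (𝓘(ℝ, ℝ).prod 𝓘(ℝ, E)) (staticMetric J gF f) q y U V).trans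
    (staticMetric_apply gF f _ _ _)).trans ?_
  rw [staticForm_apply]
  have hfst := fun U => congrArg Prod.fst (hA U)
  have hsnd := fun U => congrArg Prod.snd (hA U)
  refine congrArg₂ (· + ·) (congrArg₂ (· * ·) rfl (congrArg₂ (· * ·) (hfst U) (hfst V))) ?_
  exact congrArg₂ (fun a b => gF ((extChartAt 𝓘(ℝ, E) q.2).symm y.2) a b) (hsnd U) (hsnd V)

end Static

/-! ### The Einstein tensor on the manifold and the sign of the scalar curvature. -/

section Static

variable {E : Type*} [NormedAddCommGroup E] [NormedSpace ℝ E] [FiniteDimensional ℝ E]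
  {F : Type*} [TopologicalSpace F] [ChartedSpace E F] [IsManifold 𝓘(ℝ, E) ∞ F]
  {J : TopologicalSpace.Opens ℝ}

/-- The Einstein tensor of a standard static space-time. -/
lemma einstein_staticMetric
    (gF : Bundle.ContMDiffRiemannianMetric 𝓘(ℝ, E) ∞ E (fun x : F => TangentSpace 𝓘(ℝ, E) x))
    {f : F → ℝ} (hf : ContMDiff 𝓘(ℝ, E) 𝓘(ℝ, ℝ) ∞ f) (hpos : ∀ x, 0 < f x) (q : J × F)
    (v w : TangentSpace (𝓘(ℝ, ℝ).prod 𝓘(ℝ, E)) q) :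
    ricci (𝓘(ℝ, ℝ).prod 𝓘(ℝ, E)) (staticMetric J gF.inner f) q v w
        - 1 / 2 * scalarCurvature (𝓘(ℝ, ℝ).prod 𝓘(ℝ, E)) (staticMetric J gF.inner f) q
          * staticMetric J gF.inner f q v w
      = ricci 𝓘(ℝ, E) gF.inner q.2 v.2 w.2
        - 1 / 2 * scalarCurvature 𝓘(ℝ, E) gF.inner q.2 * staticMetric J gF.inner f q v w
        + 1 / f q.2 * tensorQ 𝓘(ℝ, E) gF.inner f q.2 v.2 w.2 := by
  have : IsManifold 𝓘(ℝ, E) 1 F := .of_le (n := ∞) (WithTop.coe_le_coe.2 le_top)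
  have hh := (contDiffAt_comp_extChartAt_symm (hf q.2)).of_le
    (m := 2) (WithTop.coe_le_coe.2 le_top)
  have hfq : (f ∘ (extChartAt 𝓘(ℝ, E) q.2).symm) (extChartAt 𝓘(ℝ, E) q.2 q.2) = f q.2 := by
    rw [Function.comp_apply, extChartAt_to_inv]
  have hG := isMetricAt_metricInChart gF q.2
  have hmet := metricInChart_staticMetric gF.inner f q
  have hE := einstein_staticForm (z := extChartAt (𝓘(ℝ, ℝ).prod 𝓘(ℝ, E)) q q) hG hh
    (hfq.trans_ne (hpos q.2).ne') v w
  have heq := hmet.eq_of_nhds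
  rw [← hmet.ricciCoord_eq] at hE
  have htr : ∀ B, metricTrace (staticForm (metricInChart 𝓘(ℝ, E) gF.inner q.2)
      (f ∘ (extChartAt 𝓘(ℝ, E) q.2).symm)) (extChartAt (𝓘(ℝ, ℝ).prod 𝓘(ℝ, E)) q q) B
      = metricTrace (metricInChart (𝓘(ℝ, ℝ).prod 𝓘(ℝ, E)) (staticMetric J gF.inner f) q)
        (extChartAt (𝓘(ℝ, ℝ).prod 𝓘(ℝ, E)) q q) B := by
    intro B
    simp only [metricTrace, sharp, heq]
  rw [htr, ← heq] at hE
  have h1 := metricInChart_self (𝓘(ℝ, ℝ).prod 𝓘(ℝ, E)) (staticMetric J gF.inner f) q v w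
  have h2 := metricInChart_self 𝓘(ℝ, E) gF.inner q.2 v.2 w.2
  -- Each quantity on the manifold is a real number equal to its coordinate counterpart; the
  -- substitution is done on bare reals, free of tangent space types.
  have congr : ∀ {r r' m m' ρ ρ' φ φ' n n' η η' : ℝ} (τ σ l : ℝ), r = r' → m' = m → ρ = ρ' →
      φ' = φ → n' = n → η = η' → r' - 1 / 2 * τ * m' = ρ' - 1 / 2 * σ * m'
        + 1 / φ' * (l * n' - η') → r - 1 / 2 * τ * m = ρ - 1 / 2 * σ * m
        + 1 / φ * (l * n - η) := by
    rintro _ _ _ _ _ _ _ _ _ _ _ _ _ _ _ rfl rfl rfl rfl rfl rfl h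
    exact h
  exact congr _ _ _ (ricci_apply _ _ q v w) h1 (ricci_apply _ _ q.2 v.2 w.2) hfq h2
    (hessian_apply _ _ _ q.2 v.2 w.2) hE

lemma scalarCurvature_nonneg
    (gF : Bundle.ContMDiffRiemannianMetric 𝓘(ℝ, E) ∞ E (fun x : F => TangentSpace 𝓘(ℝ, E) x))
    {x : F} (h : ∀ v, 0 ≤ ricci 𝓘(ℝ, E) gF.inner x v v) :
    0 ≤ scalarCurvature 𝓘(ℝ, E) gF.inner x := by
  have : IsManifold 𝓘(ℝ, E) 1 F := .of_le (n := ∞) (WithTop.coe_le_coe.2 le_top)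
  exact metricTrace_nonneg (E := E) (fun u v => gF.symm _ _ _)
    (fun v hv => (gF.pos x v hv).trans_eq (metricInChart_self 𝓘(ℝ, E) gF.inner x v v).symm)
    fun v => (h v).trans_eq (ricci_apply 𝓘(ℝ, E) gF.inner x v v)

lemma scalarCurvature_nonpos
    (gF : Bundle.ContMDiffRiemannianMetric 𝓘(ℝ, E) ∞ E (fun x : F => TangentSpace 𝓘(ℝ, E) x))
    {x : F} (h : ∀ v, ricci 𝓘(ℝ, E) gF.inner x v v ≤ 0) :
    scalarCurvature 𝓘(ℝ, E) gF.inner x ≤ 0 := by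
  have : IsManifold 𝓘(ℝ, E) 1 F := .of_le (n := ∞) (WithTop.coe_le_coe.2 le_top)
  exact metricTrace_nonpos (E := E) (fun u v => gF.symm _ _ _)
    (fun v hv => (gF.pos x v hv).trans_eq (metricInChart_self 𝓘(ℝ, E) gF.inner x v v).symm)
    fun v => (ricci_apply 𝓘(ℝ, E) gF.inner x v v).symm.trans_le (h v)

lemma nonempty_timeInterval {t₁ t₂ : EReal} (h : t₁ < t₂) : Nonempty (timeInterval t₁ t₂) := by
  obtain ⟨r, h1, h2⟩ := EReal.lt_iff_exists_real_btwn.1 h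
  exact ⟨⟨r, h1, h2⟩⟩

end Static

end StaticSpacetime

theorem theorem4p2 {s : ℕ} (hs : 2 ≤ s)
    {F : Type*} [TopologicalSpace F] [ChartedSpace (EuclideanSpace ℝ (Fin s)) F]
    [IsManifold 𝓘(ℝ, EuclideanSpace ℝ (Fin s)) ∞ F] [ConnectedSpace F]
    (gF : Bundle.ContMDiffRiemannianMetric 𝓘(ℝ, EuclideanSpace ℝ (Fin s)) ∞
      (EuclideanSpace ℝ (Fin s))
      (fun x : F => TangentSpace 𝓘(ℝ, EuclideanSpace ℝ (Fin s)) x))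
    (f : F → ℝ) (hf : ContMDiff 𝓘(ℝ, EuclideanSpace ℝ (Fin s)) 𝓘(ℝ, ℝ) ∞ f)
    (hpos : ∀ x, 0 < f x)
    (t₁ t₂ : EReal) (ht : t₁ < t₂)
    (T : ∀ q : StaticSpacetime.timeInterval t₁ t₂ × F,
      TangentSpace (𝓘(ℝ, ℝ).prod 𝓘(ℝ, EuclideanSpace ℝ (Fin s))) q →ₗ[ℝ]
        TangentSpace (𝓘(ℝ, ℝ).prod 𝓘(ℝ, EuclideanSpace ℝ (Fin s))) q →ₗ[ℝ] ℝ)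
    (hT : StaticSpacetime.EinsteinEquation (𝓘(ℝ, ℝ).prod 𝓘(ℝ, EuclideanSpace ℝ (Fin s)))
      (StaticSpacetime.staticMetric (StaticSpacetime.timeInterval t₁ t₂) gF.inner f) T) :
    -- the positive semidefinite case on causal vectors
    ((∀ x (v : TangentSpace 𝓘(ℝ, EuclideanSpace ℝ (Fin s)) x),
        0 ≤ StaticSpacetime.ricci 𝓘(ℝ, EuclideanSpace ℝ (Fin s)) gF.inner x v v) →
      (∀ x (v : TangentSpace 𝓘(ℝ, EuclideanSpace ℝ (Fin s)) x),
        0 ≤ StaticSpacetime.tensorQ 𝓘(ℝ, EuclideanSpace ℝ (Fin s)) gF.inner f x v v) →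
      ∀ (q : StaticSpacetime.timeInterval t₁ t₂ × F)
        (w : TangentSpace (𝓘(ℝ, ℝ).prod 𝓘(ℝ, EuclideanSpace ℝ (Fin s))) q),
        StaticSpacetime.staticMetric (StaticSpacetime.timeInterval t₁ t₂) gF.inner f q w w ≤ 0 →
        0 ≤ T q w w) ∧
    -- the negative semidefinite case on causal vectors
    ((∀ x (v : TangentSpace 𝓘(ℝ, EuclideanSpace ℝ (Fin s)) x),
        StaticSpacetime.ricci 𝓘(ℝ, EuclideanSpace ℝ (Fin s)) gF.inner x v v ≤ 0) →
      (∀ x (v : TangentSpace 𝓘(ℝ, EuclideanSpace ℝ (Fin s)) x),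
        StaticSpacetime.tensorQ 𝓘(ℝ, EuclideanSpace ℝ (Fin s)) gF.inner f x v v ≤ 0) →
      ∀ (q : StaticSpacetime.timeInterval t₁ t₂ × F)
        (w : TangentSpace (𝓘(ℝ, ℝ).prod 𝓘(ℝ, EuclideanSpace ℝ (Fin s))) q),
        StaticSpacetime.staticMetric (StaticSpacetime.timeInterval t₁ t₂) gF.inner f q w w ≤ 0 →
        T q w w ≤ 0) ∧
    -- the Ricci-flat case
    ((∀ x (v v' : TangentSpace 𝓘(ℝ, EuclideanSpace ℝ (Fin s)) x),
        StaticSpacetime.ricci 𝓘(ℝ, EuclideanSpace ℝ (Fin s)) gF.inner x v v' = 0) →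
      (∀ (t : StaticSpacetime.timeInterval t₁ t₂) (x : F) (u : TangentSpace 𝓘(ℝ, ℝ) t)
        (v : TangentSpace 𝓘(ℝ, EuclideanSpace ℝ (Fin s)) x),
        8 * Real.pi * T (t, x)
            (StaticSpacetime.tangentSum (StaticSpacetime.timeInterval t₁ t₂) t x u v)
            (StaticSpacetime.tangentSum (StaticSpacetime.timeInterval t₁ t₂) t x u v)
          = 1 / f x *
            StaticSpacetime.tensorQ 𝓘(ℝ, EuclideanSpace ℝ (Fin s)) gF.inner f x v v) ∧
      ((∀ x (v : TangentSpace 𝓘(ℝ, EuclideanSpace ℝ (Fin s)) x),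
          0 ≤ StaticSpacetime.tensorQ 𝓘(ℝ, EuclideanSpace ℝ (Fin s)) gF.inner f x v v) ↔
        ∀ (q : StaticSpacetime.timeInterval t₁ t₂ × F)
          (w : TangentSpace (𝓘(ℝ, ℝ).prod 𝓘(ℝ, EuclideanSpace ℝ (Fin s))) q),
          0 ≤ T q w w)) := by
  have key : ∀ q w, 8 * Real.pi * T q w w = _ := fun q w =>
    (hT q w w).symm.trans (StaticSpacetime.einstein_staticMetric gF hf hpos q w w)
  have hpi : 0 < 8 * Real.pi := by positivity
  refine ⟨fun hR hQ q w hw => ?_, fun hR hQ q w hw => ?_, fun hR => ?_⟩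
  · refine (mul_nonneg_iff_of_pos_left hpi).1 ?_
    rw [key]
    -- The only use of causality: `-τ_F g(w,w)` is a product of two nonpositive factors, `g(w,w)`
    -- and `-τ_F`.
    have h1 := mul_nonneg_of_nonpos_of_nonpos hw
      (neg_nonpos.2 (StaticSpacetime.scalarCurvature_nonneg gF (hR q.2)))
    have h2 := mul_nonneg (one_div_pos.2 (hpos q.2)).le (hQ q.2 w.2)
    have h3 := hR q.2 w.2
    linarith
  · refine le_of_mul_le_mul_left (a := 8 * Real.pi) ?_ hpi
    rw [key, mul_zero]
    have h1 := mul_nonneg_of_nonpos_of_nonpos hw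
      (StaticSpacetime.scalarCurvature_nonpos gF (hR q.2))
    have h2 := mul_nonpos_of_nonneg_of_nonpos (one_div_pos.2 (hpos q.2)).le (hQ q.2 w.2)
    have h3 := hR q.2 w.2
    linarith
  · have key' : ∀ q w, 8 * Real.pi * T q w w = 1 / f q.2 *
        StaticSpacetime.tensorQ 𝓘(ℝ, EuclideanSpace ℝ (Fin s)) gF.inner f q.2 w.2 w.2 := by
      intro q w
      -- A vanishing Ricci form is semidefinite of both signs, so its trace is squeezed to zero.
      have h0 : StaticSpacetime.scalarCurvature 𝓘(ℝ, EuclideanSpace ℝ (Fin s)) gF.inner q.2 = 0 :=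
        le_antisymm (StaticSpacetime.scalarCurvature_nonpos gF fun v => (hR _ v v).le)
          (StaticSpacetime.scalarCurvature_nonneg gF fun v => (hR _ v v).ge)
      rw [key, h0]
      linear_combination hR q.2 w.2 w.2
    have hsum : ∀ (t : StaticSpacetime.timeInterval t₁ t₂) (x : F) (u : TangentSpace 𝓘(ℝ, ℝ) t)
        (v : TangentSpace 𝓘(ℝ, EuclideanSpace ℝ (Fin s)) x),
        8 * Real.pi * T (t, x)
            (StaticSpacetime.tangentSum (StaticSpacetime.timeInterval t₁ t₂) t x u v)
            (StaticSpacetime.tangentSum (StaticSpacetime.timeInterval t₁ t₂) t x u v)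
          = 1 / f x *
            StaticSpacetime.tensorQ 𝓘(ℝ, EuclideanSpace ℝ (Fin s)) gF.inner f x v v := by
      intro t x u v
      rw [key', StaticSpacetime.tangentSum_eq]
    refine ⟨hsum, fun hQ q w => ?_, fun hTT x v => ?_⟩
    · refine (mul_nonneg_iff_of_pos_left hpi).1 ?_
      rw [key']
      exact mul_nonneg (one_div_pos.2 (hpos q.2)).le (hQ q.2 w.2)
    -- Some point of the space-time must lie over `x`; any `t` serves, and the vector tested there
    -- is `0 + v`.
    · obtain ⟨t⟩ := StaticSpacetime.nonempty_timeInterval ht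
      refine (mul_nonneg_iff_of_pos_left (one_div_pos.2 (hpos x))).1 ?_
      rw [← hsum t x 0 v]
      exact mul_nonneg hpi.le (hTT _ _)
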